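/- **Setting.** Alice and Bob share $n$ qubit pairs. For $x=x_1\cdots x_n$ with $x_j=a_jb_j\in\{0,1\}^2$ let $|\Phi_x\rangle=\bigotimes_{j}(Z^{a_j}X^{b_j}\otimes 1)|\phi^+\rangle$, where $|\phi^+\rangle=\tfrac1{\sqrt2}(|00\rangle+|11\rangle)$. Let $\rho=\sum_x P_{X^n}(x)\,|\Phi_x\rangle\langle\Phi_x|$ be a normalized Bell-diagonal state whose eigenvalues form the probability distribution $P_{X^n}$, and let $H_0(X^n)_P=\log_2|\{x:P_{X^n}(x)>0\}|$ be its Hartley entropy. *One-way hashing method.* A round on $k$ pairs draws $S=s_1\cdots s_k$, $s_j\in\{0,1\}^2$, uniformly at random (independently of the other rounds); $j^\star$ is the first index with $s_{j^\star}\ne 00$ (and $j^\star=1$ if $S=0$). For each $j$: if $s_j=10$, both parties rotate their half of pair $j$ by $\pi/2$ about the $y$-axis; if $s_j=11$, Alice and Bob rotate theirs about the $x$-axis by $3\pi/2$ and $\pi/2$, respectively. For each $j\neq j^\star$ with $s_j\ne00$, both apply a CNOT with control pair $j$ and target pair $j^\star$. Then both measure pair $j^\star$ in the computational basis and discard it.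 After the last round, given all random strings and measurement outcomes, Bob applies single-qubit Pauli gates such that the largest eigenvalue of the remaining Bell-diagonal state belongs to $|\phi^+\rangle^{\otimes(n-r)}$, where $r$ is the number of rounds. Let $\rho'_{(r)}$ denote the resulting state of the remaining $n-r$ pairs, averaged over all random strings and outcomes. Let $F(\rho,\sigma)=\bigl(\|\sqrt\rho\sqrt\sigma\|_1+\sqrt{(1-\operatorname{Tr}\rho)(1-\operatorname{Tr}\sigma)}\bigr)^2$ be the generalized fidelity and $\mathrm P(\rho,\sigma)=\sqrt{1-F(\rho,\sigma)}$ the purified distance. Define $m^\varepsilon$ as the largest $m\in\{0,\dots,n\}$ such that $\mathrm P\bigl(\rho'_{(n-m)},(|\phi^+\rangle\langle\phi^+|)^{\otimes m}\bigr)\le\varepsilon$, and, for $n\ge1$, the rate $R^\varepsilon=m^\varepsilon/n$. **Proposition (Non-tight bounds).** For every $\varepsilon>0$ with $\lceil H_0(X^n)_P-2\log_2\varepsilon\rceil\ge 0$ (in particular, for every $0<\varepsilon\le1$), $$m^\varepsilon\;\ge\; n-\bigl\lceil H_0(X^n)_P-2\log_2\varepsilon\bigr\rceil ,$$ and, for $n\ge1$,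 $$R^\varepsilon\;\ge\;\frac{n-\bigl\lceil H_0(X^n)_P-2\log_2\varepsilon\bigr\rceil}{n}.$$ -/

import Mathlib

open scoped Kronecker

noncomputable section

namespace OneWayHashing

/-! ### Distance measures and entropy -/

section Distance

variable {ι : Type} [Fintype ι] [DecidableEq ι]

/-- The square root of a positive semidefinite matrix (continuous functional calculus). -/
def matSqrt (A : Matrix ι ι ℂ) : Matrix ι ι ℂ := cfc Real.sqrt A

/-- The trace norm `‖A‖₁ = Tr √(Aᴴ A)`. -/
def traceNorm (A : Matrix ι ι ℂ) : ℝ := (matSqrt (A.conjTranspose * A)).trace.re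

/-- The generalized fidelity
`F(ρ, σ) = (‖√ρ √σ‖₁ + √((1 - Tr ρ) (1 - Tr σ)))²` of sub-normalized density matrices. -/
def fidelity (ρ σ : Matrix ι ι ℂ) : ℝ :=
  (traceNorm (matSqrt ρ * matSqrt σ) + Real.sqrt ((1 - ρ.trace.re) * (1 - σ.trace.re))) ^ 2

/-- The purified distance `P(ρ, σ) = √(1 - F(ρ, σ))`. -/
def purifiedDistance (ρ σ : Matrix ι ι ℂ) : ℝ := Real.sqrt (1 - fidelity ρ σ)

end Distance

/-- The Hartley entropy `H₀(X)_P = log₂ |{x : P(x) > 0}|`. -/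
def hartley {α : Type} (P : α → ℝ) : ℝ := Real.logb 2 (({x | 0 < P x} : Set α).ncard : ℝ)

/-! ### Qubits, Pauli operators and Bell states -/

/-- A bit; it also indexes the computational basis of one qubit. -/
abbrev Bit : Type := ZMod 2

/-- Two bits `ab` (phase bit `a`, amplitude bit `b`). -/
abbrev TwoBits : Type := Bit × Bit

/-- Computational basis of the `n` qubits held by one party. -/
abbrev Reg (n : ℕ) : Type := Fin n → Bit

/-- Operators on the `n` qubits of one party. -/
abbrev LocalOp (n : ℕ) : Type := Matrix (Reg n) (Reg n) ℂ

/-- Operators on `n` qubit pairs; the first component of an index is Alice's register `Aⁿ`,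
the second one is Bob's register `Bⁿ`. -/
abbrev PairOp (n : ℕ) : Type := Matrix (Reg n × Reg n) (Reg n × Reg n) ℂ

def pauliX : Matrix Bit Bit ℂ := Matrix.of fun a b => if a = b + 1 then 1 else 0

def pauliZ : Matrix Bit Bit ℂ := Matrix.diagonal fun a => if a = 0 then 1 else -1

/-- The Pauli operator `Z^a X^b` with label `ab`. -/
def pauli (x : TwoBits) : Matrix Bit Bit ℂ := pauliZ ^ x.1.val * pauliX ^ x.2.val

/-- The tensor product `g₁ ⊗ ⋯ ⊗ gₙ` of single-qubit operators. -/
def tensorOp {n : ℕ} (g : Fin n → Matrix Bit Bit ℂ) : LocalOp n :=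
  Matrix.of fun a b => ∏ j, g j (a j) (b j)

/-- The amplitude at `|α⟩_A |β⟩_B` of the Bell state `(Z^a X^b ⊗ 1)|φ⁺⟩` with label `x = ab`:
`00 ↦ φ⁺`, `10 ↦ φ⁻`, `01 ↦ ψ⁺`, `11 ↦ ψ⁻`. -/
def bellAmplitude (x : TwoBits) (α β : Bit) : ℂ := (Real.sqrt 2 : ℂ)⁻¹ * pauli x α β

/-- The tensor product of the Bell states with labels `x₁, …, xₙ`. -/
def bellVec {n : ℕ} (x : Fin n → TwoBits) : Reg n × Reg n → ℂ :=
  fun p => ∏ j, bellAmplitude (x j) (p.1 j) (p.2 j)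

/-- The projector onto the tensor product of Bell states with labels `x₁, …, xₙ`. -/
def bellProj {n : ℕ} (x : Fin n → TwoBits) : PairOp n :=
  Matrix.vecMulVec (bellVec x) (star (bellVec x))

/-- The target state `|φ⁺⟩⟨φ⁺|^{⊗ n}`. -/
def targetState (n : ℕ) : PairOp n := bellProj (fun _ => 0)

/-- `ρ` is a normalized Bell-diagonal density matrix, and `P` is the probability distribution
formed by its eigenvalues: `ρ = ∑ₓ P(x) |Φₓ⟩⟨Φₓ|`. -/
structure IsBellDiagonalState {n : ℕ} (ρ : PairOp n) (P : (Fin n → TwoBits) → ℝ) : Prop where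
  nonneg : ∀ x, 0 ≤ P x
  sum_eq_one : ∑ x, P x = 1
  eq_sum : ρ = ∑ x, (P x : ℂ) • bellProj x

/-! ### One round of the one-way hashing method -/

/-- Rotation by `θ` around the `x`-axis, `exp(-i θ X / 2)`. -/
def rotX (θ : ℝ) : Matrix Bit Bit ℂ :=
  (Real.cos (θ / 2) : ℂ) • 1 - (Complex.I * (Real.sin (θ / 2) : ℂ)) • pauliX

/-- Rotation by `θ` around the `y`-axis, `exp(-i θ Y / 2)`; here `Y = i X Z`. -/
def rotY (θ : ℝ) : Matrix Bit Bit ℂ :=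
  (Real.cos (θ / 2) : ℂ) • 1 -
    (Complex.I * (Real.sin (θ / 2) : ℂ)) • (Complex.I • (pauliX * pauliZ))

/-- Alice's rotation of the `j`-th pair when `s_j = s`. -/
def aliceRotation (s : TwoBits) : Matrix Bit Bit ℂ :=
  if s = (1, 0) then rotY (Real.pi / 2)
  else if s = (1, 1) then rotX (3 * Real.pi / 2)
  else 1

/-- Bob's rotation of the `j`-th pair when `s_j = s`. -/
def bobRotation (s : TwoBits) : Matrix Bit Bit ℂ :=
  if s = (1, 0) then rotY (Real.pi / 2)
  else if s = (1, 1) then rotX (Real.pi / 2)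
  else 1

/-- The index `j⋆` of the first non-zero two-bit string; the first pair if there is none. -/
def jstar {m : ℕ} (s : Fin (m + 1) → TwoBits) : Fin (m + 1) :=
  if h : (Finset.univ.filter fun j => s j ≠ 0).Nonempty then
    (Finset.univ.filter fun j => s j ≠ 0).min' h
  else 0

/-- One party's CNOT gates with control `j` and target `j⋆`, for all `j ≠ j⋆` with `s_j ≠ 00`.
They share their target, hence commute, and together they add all the control bits to the
target bit. -/
def cnotLayer {m : ℕ} (s : Fin (m + 1) → TwoBits) : LocalOp (m + 1) :=
  Matrix.of fun a b =>
    if a = Function.update b (jstar s)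
        (b (jstar s) + ∑ j ∈ Finset.univ.filter (fun j => j ≠ jstar s ∧ s j ≠ 0), b j)
    then 1 else 0

/-- The joint unitary of Alice and Bob in one round: local rotations, then bilateral CNOTs. -/
def roundUnitary {m : ℕ} (s : Fin (m + 1) → TwoBits) : PairOp (m + 1) :=
  (cnotLayer s * tensorOp fun j => aliceRotation (s j)) ⊗ₖ
    (cnotLayer s * tensorOp fun j => bobRotation (s j))

/-- Measuring pair `j` in the computational basis, with outcomes `y.1` for Alice and `y.2` for
Bob, and discarding it: the unnormalized state `⟨y|ρ|y⟩` of the other pairs, whose trace is the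
probability of `y`. -/
def measureAndDiscard {m : ℕ} (j : Fin (m + 1)) (y : Bit × Bit) (ρ : PairOp (m + 1)) : PairOp m :=
  ρ.submatrix
    (fun p => (j.insertNth (α := fun _ => Bit) y.1 p.1, j.insertNth (α := fun _ => Bit) y.2 p.2))
    (fun p => (j.insertNth (α := fun _ => Bit) y.1 p.1, j.insertNth (α := fun _ => Bit) y.2 p.2))

/-- The unnormalized state after one round with string `s` and measurement outcomes `y`. -/
def roundBranch {m : ℕ} (s : Fin (m + 1) → TwoBits) (y : Bit × Bit) (ρ : PairOp (m + 1)) :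
    PairOp m :=
  measureAndDiscard (jstar s) y (roundUnitary s * ρ * (roundUnitary s).conjTranspose)

/-! ### The full protocol -/

/-- The classical registers of `r` rounds that start with `m + r` pairs and end with `m` pairs:
for each round its random string and the measurement outcomes of Alice and Bob. -/
def Transcript (m : ℕ) : ℕ → Type
  | 0 => Unit
  | r + 1 => ((Fin (m + r + 1) → TwoBits) × (Bit × Bit)) × Transcript m r

instance instFintypeTranscript (m : ℕ) : (r : ℕ) → Fintype (Transcript m r)
  | 0 => inferInstanceAs (Fintype Unit)
  | r + 1 =>
    haveI := instFintypeTranscript m r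
    inferInstanceAs (Fintype (((Fin (m + r + 1) → TwoBits) × (Bit × Bit)) × Transcript m r))

/-- `Pr(Y = y ∧ S = s) ρ_{|Y = y, S = s}` after `r` rounds and before post-processing, where
`(s, y)` is the transcript. The string of each round is uniform and independent of the others. -/
def branch (m : ℕ) : (r : ℕ) → PairOp (m + r) → Transcript m r → PairOp m
  | 0, ρ, _ => ρ
  | r + 1, ρ, t =>
    branch m r
      ((Fintype.card (Fin (m + r + 1) → TwoBits) : ℂ)⁻¹ • roundBranch t.1.1 t.1.2 ρ) t.2

/-- The eigenvalue `⟨Φₓ|ρ|Φₓ⟩` of a (possibly unnormalized) Bell-diagonal `ρ` at label `x`. -/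
def bellEigenvalue {m : ℕ} (ρ : PairOp m) (x : Fin m → TwoBits) : ℝ :=
  (star (bellVec x) ⬝ᵥ ρ.mulVec (bellVec x)).re

/-- A label at which the eigenvalue of `ρ` is maximal. -/
def topLabel {m : ℕ} (ρ : PairOp m) : Fin m → TwoBits :=
  Classical.choose (Finite.exists_max (bellEigenvalue ρ))

/-- Bob's single-qubit Pauli gates that move the Bell state with label `x` to `φ⁺` on every pair. -/
def bobCorrection {m : ℕ} (x : Fin m → TwoBits) : PairOp m :=
  (1 : LocalOp m) ⊗ₖ tensorOp fun j => pauli (x j)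

/-- Post-processing: Bob's Pauli gates make the largest eigenvalue correspond to `φ⁺^{⊗ m}`. -/
def postProcess {m : ℕ} (ρ : PairOp m) : PairOp m :=
  bobCorrection (topLabel ρ) * ρ * (bobCorrection (topLabel ρ)).conjTranspose

/-- The output of `r` rounds of the one-way hashing method on `m + r` pairs, after tracing out
the classical registers: `∑_{y, s} Pr(Y = y ∧ S = s) ρ'_{|Y = y, S = s}`. -/
def hashOutput (m r : ℕ) (ρ : PairOp (m + r)) : PairOp m :=
  ∑ t : Transcript m r, postProcess (branch m r ρ t)

/-- `m^ε`: the largest `m` for which running `r = n - m` rounds of the one-way hashing method on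
`ρ` yields `m` pairs that are `ε`-close to `m` Bell pairs in purified distance. -/
def maxBellPairs {n : ℕ} (ρ : PairOp n) (ε : ℝ) : ℕ :=
  sSup {m : ℕ | ∃ (r : ℕ) (h : n = m + r),
    purifiedDistance (hashOutput m r (h ▸ ρ)) (targetState m) ≤ ε}

/-- The distillation rate `R^ε = m^ε / n`. -/
def distillationRate {n : ℕ} (ρ : PairOp n) (ε : ℝ) : ℝ := (maxBellPairs ρ ε : ℝ) / n

end OneWayHashing

end

open scoped ComplexOrder

noncomputable section

namespace OneWayHashing

/-! ### Action of one round on Bell states -/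

/-! Each round sends a Bell state to a Bell state and reveals one bit of its label `x`. The
rotations move the bit `s_j · x_j` into the amplitude slot of every pair with `s_j ≠ 0`, the CNOTs
add these bits into pair `j⋆`, and the parity of the two outcomes is `labelDot s x`
(`roundBranch_bellProj`, `roundParity_eq_labelDot`). For `s = 0` the parity is some other function
of `x`, which does no harm.

For uniform `s`, two different labels have equal parities with probability at most 1/2
(`two_mul_card_roundParity_eq_le`). Hence `r` rounds leave a given pair of labels both
undistinguished and in different Bell states with probability at most `2^(-r)` (`collisionProb_le`).
A union bound over the support shows that guessing the final label from the transcript fails with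
probability at most `|supp P| / 2^r`.

The target is pure, so the fidelity is an overlap, linear in the output, and equals the sum over
transcripts of the largest Bell eigenvalue (`fidelity_hashOutput`). This is at least the success
probability of any guess. Choosing `r` with `|supp P| / 2^r ≤ ε²` gives the bound. -/

/-- The sign `(-1)^z`. -/
def bitSign (z : Bit) : ℂ := if z = 0 then 1 else -1

lemma bit_eq_zero_or_one (a : Bit) : a = 0 ∨ a = 1 := by revert a; decide

lemma bit_one_add_one : (1 : Bit) + 1 = 0 := rfl

lemma bit_sum (f : Bit → ℂ) : ∑ a, f a = f 0 + f 1 := Fin.sum_univ_two f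

lemma bitSign_add (a b : Bit) : bitSign (a + b) = bitSign a * bitSign b := by
  rcases bit_eq_zero_or_one a with rfl | rfl <;> rcases bit_eq_zero_or_one b with rfl | rfl <;>
    simp [bitSign, bit_one_add_one]

lemma bitSign_sum {ι : Type} (t : Finset ι) (f : ι → Bit) :
    bitSign (∑ j ∈ t, f j) = ∏ j ∈ t, bitSign (f j) := by
  classical
  induction t using Finset.induction_on with
  | empty => simp [bitSign]
  | insert a t ha ih => rw [Finset.sum_insert ha, Finset.prod_insert ha, bitSign_add, ih]

lemma bitSign_mul_star (a : Bit) : bitSign a * star (bitSign a) = 1 := by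
  unfold bitSign; split_ifs <;> simp

lemma pauli_apply (x : TwoBits) (α β : Bit) :
    pauli x α β = bitSign (x.1 * α) * if α = β + x.2 then 1 else 0 := by
  obtain ⟨a, b⟩ := x
  have h1 : ZMod.val (1 : ZMod 2) = 1 := rfl
  rcases bit_eq_zero_or_one a with rfl | rfl <;> rcases bit_eq_zero_or_one b with rfl | rfl <;>
    simp [pauli, pauliX, pauliZ, bitSign, h1, Matrix.one_apply]

/-- The label of a Bell state after the local rotations for the two-bit string `s`. -/
def rotLabel (s x : TwoBits) : TwoBits :=
  if s = (1, 0) then (x.2, x.1) else if s = (1, 1) then (x.1, x.1 + x.2) else x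

/-- The phase that a Bell state acquires under the local rotations. -/
def rotPhase (s x : TwoBits) : ℂ :=
  if s = (1, 0) then (if x = (0, 1) then -1 else 1)
  else if s = (1, 1) then (if x.1 = 0 then -1 else Complex.I)
  else 1

lemma rotPhase_mul_star (s x : TwoBits) : rotPhase s x * star (rotPhase s x) = 1 := by
  unfold rotPhase; split_ifs <;> simp

lemma rotY_pi_div_two :
    rotY (Real.pi / 2) =
      ((Real.sqrt 2 / 2 : ℝ) : ℂ) • Matrix.of fun a b : Bit => if a = 0 ∧ b = 1 then -1 else 1 := by
  have h : Real.pi / 2 / 2 = Real.pi / 4 := by ring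
  rw [rotY, h, Real.cos_pi_div_four, Real.sin_pi_div_four, smul_smul,
    show Complex.I * ((Real.sqrt 2 / 2 : ℝ) : ℂ) * Complex.I = -((Real.sqrt 2 / 2 : ℝ) : ℂ) by
      rw [mul_right_comm, Complex.I_mul_I, neg_one_mul]]
  ext i j
  rcases bit_eq_zero_or_one i with rfl | rfl <;> rcases bit_eq_zero_or_one j with rfl | rfl <;>
    simp [pauliX, pauliZ, bit_one_add_one]

lemma rotX_eq_of {θ c s : ℝ} (hc : Real.cos (θ / 2) = c) (hs : Real.sin (θ / 2) = s) :
    rotX θ = Matrix.of fun a b : Bit => if a = b then (c : ℂ) else -Complex.I * s := by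
  rw [rotX, hc, hs]
  ext i j
  rcases bit_eq_zero_or_one i with rfl | rfl <;> rcases bit_eq_zero_or_one j with rfl | rfl <;>
    simp [pauliX, bit_one_add_one]

lemma rotX_pi_div_two :
    rotX (Real.pi / 2) = ((Real.sqrt 2 / 2 : ℝ) : ℂ) •
      Matrix.of fun a b : Bit => if a = b then 1 else -Complex.I := by
  have h : Real.pi / 2 / 2 = Real.pi / 4 := by ring
  rw [rotX_eq_of (h ▸ Real.cos_pi_div_four) (h ▸ Real.sin_pi_div_four)]
  ext i j
  simp only [Matrix.of_apply, Matrix.smul_apply, smul_eq_mul]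
  split_ifs <;> ring

lemma rotX_three_pi_div_two :
    rotX (3 * Real.pi / 2) = ((Real.sqrt 2 / 2 : ℝ) : ℂ) •
      Matrix.of fun a b : Bit => if a = b then -1 else -Complex.I := by
  have h : 3 * Real.pi / 2 / 2 = Real.pi - Real.pi / 4 := by ring
  rw [rotX_eq_of (c := -(Real.sqrt 2 / 2)) (s := Real.sqrt 2 / 2)
    (by rw [h, Real.cos_pi_sub, Real.cos_pi_div_four])
    (by rw [h, Real.sin_pi_sub, Real.sin_pi_div_four])]
  ext i j
  simp only [Matrix.of_apply, Matrix.smul_apply, smul_eq_mul, Complex.ofReal_neg]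
  split_ifs <;> ring

/-- Seen as a 2×2 matrix, a two-qubit vector `M` is mapped by `A ⊗ B` to `A M Bᵀ`, so this finite
check is the action of the local rotations on one Bell pair. -/
lemma rotation_mul_pauli (s x : TwoBits) :
    aliceRotation s * pauli x * (bobRotation s).transpose
      = rotPhase s x • pauli (rotLabel s x) := by
  have hs : ((Real.sqrt 2 / 2 : ℝ) : ℂ) * ((Real.sqrt 2 / 2 : ℝ) : ℂ) = 1 / 2 := by
    rw [← Complex.ofReal_mul, div_mul_div_comm, Real.mul_self_sqrt (by norm_num)]; norm_num
  have hsm : ∀ (c : ℂ) (A B C : Matrix Bit Bit ℂ),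
      c • A * B * (c • C).transpose = (c * c) • (A * B * C.transpose) := fun c A B C => by
    rw [Matrix.transpose_smul, Matrix.smul_mul, Matrix.smul_mul, Matrix.mul_smul, smul_smul]
  obtain ⟨a, b⟩ := x
  by_cases h1 : s = (1, 0)
  · simp only [aliceRotation, bobRotation, rotPhase, rotLabel, h1, if_true, rotY_pi_div_two, hsm, hs]
    ext i j
    rcases bit_eq_zero_or_one a with rfl | rfl <;> rcases bit_eq_zero_or_one b with rfl | rfl <;>
    rcases bit_eq_zero_or_one i with rfl | rfl <;> rcases bit_eq_zero_or_one j with rfl | rfl <;>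
    simp [pauli_apply, bitSign, Matrix.mul_apply, bit_sum, bit_one_add_one] <;> norm_num
  by_cases h2 : s = (1, 1)
  · have h3 : ((1, 1) : TwoBits) ≠ (1, 0) := by decide
    simp only [aliceRotation, bobRotation, rotPhase, rotLabel, h2, h3, if_true, if_false,
      rotX_pi_div_two, rotX_three_pi_div_two, hsm, hs]
    ext i j
    rcases bit_eq_zero_or_one a with rfl | rfl <;> rcases bit_eq_zero_or_one b with rfl | rfl <;>
    rcases bit_eq_zero_or_one i with rfl | rfl <;> rcases bit_eq_zero_or_one j with rfl | rfl <;>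
    simp [pauli_apply, bitSign, Matrix.mul_apply, bit_sum, bit_one_add_one] <;> ring
  · simp [aliceRotation, bobRotation, rotPhase, rotLabel, h1, h2]

lemma tensorOp_mul {n : ℕ} (g h : Fin n → Matrix Bit Bit ℂ) :
    tensorOp g * tensorOp h = tensorOp fun j => g j * h j := by
  ext a b
  simp only [tensorOp, Matrix.mul_apply, Matrix.of_apply, Finset.prod_univ_sum,
    Fintype.piFinset_univ, Finset.prod_mul_distrib]

lemma tensorOp_transpose {n : ℕ} (g : Fin n → Matrix Bit Bit ℂ) :
    (tensorOp g).transpose = tensorOp fun j => (g j).transpose := rfl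

lemma kronecker_mulVec_apply {ι : Type} [Fintype ι] (A B M : Matrix ι ι ℂ) (q : ι × ι) :
    ((A ⊗ₖ B).mulVec fun p => M p.1 p.2) q = (A * M * B.transpose) q.1 q.2 := by
  simp only [Matrix.mulVec, dotProduct, Fintype.sum_prod_type, Matrix.mul_apply, Finset.sum_mul,
    Matrix.transpose_apply, Matrix.kroneckerMap_apply]
  rw [Finset.sum_comm]
  exact Finset.sum_congr rfl fun _ _ => Finset.sum_congr rfl fun _ _ => by ring

/-- The indices of the control pairs of a round. -/
def controls {m : ℕ} (s : Fin (m + 1) → TwoBits) : Finset (Fin (m + 1)) :=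
  Finset.univ.filter fun j => j ≠ jstar s ∧ s j ≠ 0

/-- The action of the CNOT layer on computational basis states. -/
def cnotMap {m : ℕ} (s : Fin (m + 1) → TwoBits) (b : Reg (m + 1)) : Reg (m + 1) :=
  Function.update b (jstar s) (b (jstar s) + ∑ j ∈ controls s, b j)

lemma ne_jstar_of_mem_controls {m : ℕ} {s : Fin (m + 1) → TwoBits} {j : Fin (m + 1)}
    (h : j ∈ controls s) : j ≠ jstar s := (Finset.mem_filter.1 h).2.1

lemma cnotMap_involutive {m : ℕ} (s : Fin (m + 1) → TwoBits) :
    Function.Involutive (cnotMap s) := by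
  intro b
  have h : ∑ j ∈ controls s, cnotMap s b j = ∑ j ∈ controls s, b j :=
    Finset.sum_congr rfl fun j hj => Function.update_of_ne (ne_jstar_of_mem_controls hj) _ _
  rw [cnotMap, h]
  simp only [cnotMap, Function.update_self, Function.update_idem, add_assoc,
    CharTwo.add_self_eq_zero, add_zero, Function.update_eq_self]

lemma cnotLayer_apply {m : ℕ} (s : Fin (m + 1) → TwoBits) (a b : Reg (m + 1)) :
    cnotLayer s a b = if b = cnotMap s a then 1 else 0 := by
  have h : (a = cnotMap s b) ↔ (b = cnotMap s a) :=
    ⟨fun h => by rw [h, cnotMap_involutive], fun h => by rw [h, cnotMap_involutive]⟩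
  rw [← if_congr h rfl rfl]; rfl

/-- The CNOT layer is the permutation matrix of an involution, so it only relabels rows and columns.
-/
lemma cnotLayer_conj_apply {m : ℕ} (s : Fin (m + 1) → TwoBits) (M : LocalOp (m + 1))
    (a b : Reg (m + 1)) :
    (cnotLayer s * M * (cnotLayer s).transpose) a b = M (cnotMap s a) (cnotMap s b) := by
  simp [Matrix.mul_apply, cnotLayer_apply]

lemma roundUnitary_mulVec_bellVec {m : ℕ} (s x : Fin (m + 1) → TwoBits)
    (p : Reg (m + 1) × Reg (m + 1)) :
    (roundUnitary s).mulVec (bellVec x) p =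
      (∏ j, rotPhase (s j) (x j)) *
        bellVec (fun j => rotLabel (s j) (x j)) (cnotMap s p.1, cnotMap s p.2) := by
  have h : bellVec x = fun p => (tensorOp fun j => (Real.sqrt 2 : ℂ)⁻¹ • pauli (x j)) p.1 p.2 := rfl
  rw [h, roundUnitary, kronecker_mulVec_apply, Matrix.transpose_mul]
  rw [show ∀ C A M B : LocalOp (m + 1), C * A * M * (B * C.transpose)
    = C * (A * M * B) * C.transpose from fun C A M B => by simp only [mul_assoc],
    cnotLayer_conj_apply, tensorOp_transpose, tensorOp_mul, tensorOp_mul]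
  simp only [mul_smul_comm, smul_mul_assoc, rotation_mul_pauli, tensorOp, Matrix.of_apply,
    Matrix.smul_apply, smul_eq_mul, bellVec, bellAmplitude]
  rw [← Finset.prod_mul_distrib]
  exact Finset.prod_congr rfl fun _ _ => by ring

/-- The parity of the measurement outcomes of a round on a Bell state. -/
def roundParity {m : ℕ} (s x : Fin (m + 1) → TwoBits) : Bit :=
  (rotLabel (s (jstar s)) (x (jstar s))).2 + ∑ j ∈ controls s, (rotLabel (s j) (x j)).2

/-- The label of the remaining pairs after a round on a Bell state. -/
def roundLabel {m : ℕ} (s x : Fin (m + 1) → TwoBits) (i : Fin m) : TwoBits :=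
  ((rotLabel (s ((jstar s).succAbove i)) (x ((jstar s).succAbove i))).1 +
      (if (jstar s).succAbove i ∈ controls s then (rotLabel (s (jstar s)) (x (jstar s))).1 else 0),
    (rotLabel (s ((jstar s).succAbove i)) (x ((jstar s).succAbove i))).2)

lemma sum_controls {m : ℕ} (s : Fin (m + 1) → TwoBits) (f : Fin (m + 1) → Bit) :
    ∑ j ∈ controls s, f j =
      ∑ i, if (jstar s).succAbove i ∈ controls s then f ((jstar s).succAbove i) else 0 := by
  have h : ∑ j ∈ controls s, f j = ∑ j, if j ∈ controls s then f j else 0 := by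
    rw [← Finset.sum_filter, Finset.filter_mem_eq_inter, Finset.univ_inter]
  rw [h, Fin.sum_univ_succAbove _ (jstar s),
    if_neg fun hj => ne_jstar_of_mem_controls hj rfl, zero_add]

lemma bellAmplitude_eq (x : TwoBits) (α β : Bit) :
    bellAmplitude x α β =
      (Real.sqrt 2 : ℂ)⁻¹ * (bitSign (x.1 * α) * if α = β + x.2 then 1 else 0) := by
  rw [bellAmplitude, pauli_apply]

/-- The target pair, with label `X0`, collects the amplitude bits of the controls `C`, while its
phase bit is kicked back onto each control. Both sides vanish unless Alice's and Bob's bits differ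
by the amplitude bit on every remaining pair; on that set the identity follows from additivity of
the signs. -/
lemma cnot_bell_product {m : ℕ} (C : Fin m → Prop) [DecidablePred C] (X : Fin m → TwoBits)
    (X0 : TwoBits) (y : Bit × Bit) (p : Reg m × Reg m) :
    (Real.sqrt 2 : ℂ)⁻¹ * (bitSign (X0.1 * (y.1 + ∑ i, if C i then p.1 i else 0)) *
        if (y.1 + ∑ i, if C i then p.1 i else 0) =
          (y.2 + ∑ i, if C i then p.2 i else 0) + X0.2 then 1 else 0) *
      ∏ i, (Real.sqrt 2 : ℂ)⁻¹ *
        (bitSign ((X i).1 * p.1 i) * if p.1 i = p.2 i + (X i).2 then 1 else 0) =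
    ((Real.sqrt 2 : ℂ)⁻¹ * bitSign (X0.1 * y.1) *
        if y.1 = y.2 + (X0.2 + ∑ i, if C i then (X i).2 else 0) then 1 else 0) *
      ∏ i, (Real.sqrt 2 : ℂ)⁻¹ * (bitSign (((X i).1 + if C i then X0.1 else 0) * p.1 i) *
        if p.1 i = p.2 i + (X i).2 then 1 else 0) := by
  by_cases h : ∀ i, p.1 i = p.2 i + (X i).2
  · have hsum : (∑ i, if C i then p.1 i else 0) =
        (∑ i, if C i then p.2 i else 0) + ∑ i, if C i then (X i).2 else 0 := by
      rw [← Finset.sum_add_distrib]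
      exact Finset.sum_congr rfl fun i _ => by split_ifs <;> simp [h i]
    have hiff : (y.1 + (∑ i, if C i then p.1 i else 0) =
        y.2 + (∑ i, if C i then p.2 i else 0) + X0.2) ↔
        y.1 = y.2 + (X0.2 + ∑ i, if C i then (X i).2 else 0) := by
      rw [hsum]
      generalize (∑ i, if C i then p.2 i else 0) = u
      generalize (∑ i, if C i then (X i).2 else 0) = v
      generalize X0.2 = w
      generalize y.1 = c
      generalize y.2 = d
      revert u v w c d
      decide
    have hsign : bitSign (X0.1 * (y.1 + ∑ i, if C i then p.1 i else 0)) =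
        bitSign (X0.1 * y.1) * ∏ i, bitSign ((if C i then X0.1 else 0) * p.1 i) := by
      rw [mul_add, bitSign_add, Finset.mul_sum, bitSign_sum]
      congr 1
      exact Finset.prod_congr rfl fun i _ => by split_ifs <;> simp
    have hone : ∀ i, (if p.1 i = p.2 i + (X i).2 then (1 : ℂ) else 0) = 1 := fun i => if_pos (h i)
    simp only [hiff, hsign, hone, mul_one, Finset.prod_mul_distrib, add_mul, bitSign_add]
    ring
  · obtain ⟨i, hi⟩ := not_forall.1 h
    rw [Finset.prod_eq_zero (Finset.mem_univ i) (by simp [hi]),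
      Finset.prod_eq_zero (Finset.mem_univ i) (by simp [hi]), mul_zero, mul_zero]

lemma bellVec_cnotMap_insertNth {m : ℕ} (s x : Fin (m + 1) → TwoBits) (y : Bit × Bit)
    (p : Reg m × Reg m) :
    bellVec (fun j => rotLabel (s j) (x j))
        (cnotMap s ((jstar s).insertNth (α := fun _ => Bit) y.1 p.1),
          cnotMap s ((jstar s).insertNth (α := fun _ => Bit) y.2 p.2)) =
      ((Real.sqrt 2 : ℂ)⁻¹ * bitSign ((rotLabel (s (jstar s)) (x (jstar s))).1 * y.1) *
        if y.1 = y.2 + roundParity s x then 1 else 0) * bellVec (roundLabel s x) p := by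
  simp only [bellVec, roundParity, roundLabel]
  rw [Fin.prod_univ_succAbove _ (jstar s)]
  have hi : ∀ (b : Bit) (q : Reg m) (i : Fin m),
      cnotMap s ((jstar s).insertNth (α := fun _ => Bit) b q) ((jstar s).succAbove i) = q i :=
    fun b q i => by
      rw [cnotMap, Function.update_of_ne (Fin.succAbove_ne _ _), Fin.insertNth_apply_succAbove]
  have hJ : ∀ (b : Bit) (q : Reg m),
      cnotMap s ((jstar s).insertNth (α := fun _ => Bit) b q) (jstar s) =
        b + ∑ i, if (jstar s).succAbove i ∈ controls s then q i else 0 := fun b q => by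
    rw [cnotMap, Function.update_self, Fin.insertNth_apply_same, sum_controls]
    simp only [Fin.insertNth_apply_succAbove]
  simp only [hi, hJ, sum_controls s, bellAmplitude_eq]
  exact cnot_bell_product _ _ _ _ _

/-- Phases cancel in the projector, and the amplitude `1/√2` of the measured pair squares to the
probability 1/2 of each of the two compatible outcomes. -/
lemma roundBranch_bellProj {m : ℕ} (s x : Fin (m + 1) → TwoBits) (y : Bit × Bit) :
    roundBranch s y (bellProj x) =
      (if y.1 = y.2 + roundParity s x then (1 / 2 : ℂ) else 0) • bellProj (roundLabel s x) := by
  have hU : roundUnitary s * bellProj x * (roundUnitary s).conjTranspose =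
      Matrix.vecMulVec ((roundUnitary s).mulVec (bellVec x))
        (star ((roundUnitary s).mulVec (bellVec x))) := by
    rw [bellProj, Matrix.mul_vecMulVec, Matrix.vecMulVec_mul, Matrix.star_mulVec]
  have hphase : (∏ j, rotPhase (s j) (x j)) * star (∏ j, rotPhase (s j) (x j)) = 1 := by
    rw [star_prod, ← Finset.prod_mul_distrib]
    exact Finset.prod_eq_one fun j _ => rotPhase_mul_star _ _
  have hsqrt : (Real.sqrt 2 : ℂ)⁻¹ * star (Real.sqrt 2 : ℂ)⁻¹ = 1 / 2 := by
    rw [star_inv₀, Complex.star_def, Complex.conj_ofReal, ← mul_inv, ← Complex.ofReal_mul,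
      Real.mul_self_sqrt (by norm_num)]
    norm_num
  ext p q
  rw [roundBranch, hU]
  simp only [measureAndDiscard, Matrix.submatrix_apply, Matrix.vecMulVec_apply, Pi.star_apply,
    roundUnitary_mulVec_bellVec, bellVec_cnotMap_insertNth, Matrix.smul_apply, bellProj, star_mul',
    smul_eq_mul]
  have hsign := bitSign_mul_star ((rotLabel (s (jstar s)) (x (jstar s))).1 * y.1)
  split_ifs with h
  · rw [star_one]
    generalize (∏ j, rotPhase (s j) (x j)) = c at hphase ⊢
    generalize bitSign ((rotLabel (s (jstar s)) (x (jstar s))).1 * y.1) = d at hsign ⊢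
    generalize bellVec (roundLabel s x) p = v
    generalize star (bellVec (roundLabel s x) q) = w
    generalize (Real.sqrt 2 : ℂ)⁻¹ = a at hsqrt ⊢
    linear_combination a * star a * d * star d * (v * w) * hphase + a * star a * (v * w) * hsign +
      v * w * hsqrt
  · simp

/-! ### The parity is a uniformly random linear functional of the label -/

/-- The bilinear form `s₁ x₁ + s₂ x₂` on labels. -/
def labelDot {n : ℕ} (s x : Fin n → TwoBits) : Bit :=
  ∑ j, ((s j).1 * (x j).1 + (s j).2 * (x j).2)

lemma rotLabel_snd {s : TwoBits} (hs : s ≠ 0) (x : TwoBits) :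
    (rotLabel s x).2 = s.1 * x.1 + s.2 * x.2 := by
  revert s x; decide

lemma apply_jstar_ne_zero {m : ℕ} {s : Fin (m + 1) → TwoBits} (hs : s ≠ 0) : s (jstar s) ≠ 0 := by
  obtain ⟨j, hj⟩ := Function.ne_iff.1 hs
  have h : (Finset.univ.filter fun j => s j ≠ 0).Nonempty := ⟨j, by simpa using hj⟩
  rw [jstar, dif_pos h]
  exact (Finset.mem_filter.1 (Finset.min'_mem _ h)).2

/-- Pairs with `s_j = 0` contribute to neither side. For `s = 0` the identity fails, because the
first pair is measured anyway. -/
lemma roundParity_eq_labelDot {m : ℕ} {s : Fin (m + 1) → TwoBits} (hs : s ≠ 0)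
    (x : Fin (m + 1) → TwoBits) : roundParity s x = labelDot s x := by
  rw [roundParity, labelDot, ← Finset.add_sum_erase _ _ (Finset.mem_univ (jstar s)),
    rotLabel_snd (apply_jstar_ne_zero hs)]
  congr 1
  refine (Finset.sum_congr rfl fun j hj =>
    rotLabel_snd (Finset.mem_filter.1 hj).2.2 (x j)).trans (Finset.sum_subset ?_ ?_)
  · intro j hj
    exact Finset.mem_erase.2 ⟨ne_jstar_of_mem_controls hj, Finset.mem_univ _⟩
  · intro j hj hj'
    have : s j = 0 := by
      by_contra h
      exact hj' (Finset.mem_filter.2 ⟨Finset.mem_univ _, (Finset.mem_erase.1 hj).1, h⟩)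
    simp [this]

lemma labelDot_add_left {n : ℕ} (s t x : Fin n → TwoBits) :
    labelDot (s + t) x = labelDot s x + labelDot t x := by
  simp only [labelDot, ← Finset.sum_add_distrib, Pi.add_apply, Prod.fst_add, Prod.snd_add]
  exact Finset.sum_congr rfl fun _ _ => by ring

lemma labelDot_add_right {n : ℕ} (s x y : Fin n → TwoBits) :
    labelDot s (x + y) = labelDot s x + labelDot s y := by
  simp only [labelDot, ← Finset.sum_add_distrib, Pi.add_apply, Prod.fst_add, Prod.snd_add]
  exact Finset.sum_congr rfl fun _ _ => by ring

lemma exists_labelDot_eq_one {n : ℕ} {x : Fin n → TwoBits} (hx : x ≠ 0) :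
    ∃ e, labelDot e x = 1 := by
  obtain ⟨j, hj⟩ := Function.ne_iff.1 hx
  have h : ∀ c : TwoBits, c ≠ 0 → ∃ d : TwoBits, d.1 * c.1 + d.2 * c.2 = 1 := by decide
  obtain ⟨d, hd⟩ := h _ hj
  refine ⟨Pi.single j d, ?_⟩
  rw [labelDot, Finset.sum_eq_single j _ (by simp), Pi.single_eq_same, hd]
  intro i _ hi
  simp [Pi.single_eq_of_ne hi]

lemma bit_add_eq_zero_iff (a b : Bit) : a + b = 0 ↔ a = b := by revert a b; decide

/-- Translation by a string `e` with `labelDot e (u + v) = 1` exchanges the kernel of `labelDot · (u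
+ v)` with its complement, so exactly half of the strings lie outside the kernel. Those are nonzero
and separate `u` from `v`. -/
lemma two_mul_card_roundParity_eq_le {m : ℕ} {u v : Fin (m + 1) → TwoBits} (huv : u ≠ v) :
    2 * (Finset.univ.filter fun s => roundParity s u = roundParity s v).card ≤
      Fintype.card (Fin (m + 1) → TwoBits) := by
  classical
  have hd : u + v ≠ 0 := fun h => huv (funext fun j => by
    have := congrFun h j
    exact Prod.ext ((bit_add_eq_zero_iff _ _).1 (congrArg Prod.fst this))
      ((bit_add_eq_zero_iff _ _).1 (congrArg Prod.snd this)))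
  obtain ⟨e, he⟩ := exists_labelDot_eq_one hd
  have hcompl : (Finset.univ.filter fun s : Fin (m + 1) → TwoBits => ¬ labelDot s (u + v) = 0).card
      = (Finset.univ.filter fun s : Fin (m + 1) → TwoBits => labelDot s (u + v) = 0).card := by
    refine Finset.card_bij (fun s _ => s + e) ?_ (fun _ _ _ _ h => add_right_cancel h) ?_
    · intro s hs
      have h1 : ∀ a : Bit, ¬ a = 0 → a + 1 = 0 := by decide
      simpa [labelDot_add_left, he] using h1 _ (Finset.mem_filter.1 hs).2
    · intro s hs
      refine ⟨s - e, ?_, sub_add_cancel _ _⟩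
      have h1 : labelDot (s - e) (u + v) + 1 = 0 := by
        rw [← he, ← labelDot_add_left, sub_add_cancel]; exact (Finset.mem_filter.1 hs).2
      have h2 : ∀ a : Bit, a + 1 = 0 → ¬ a = 0 := by decide
      exact Finset.mem_filter.2 ⟨Finset.mem_univ _, h2 _ h1⟩
  have hne : (Finset.univ.filter fun s : Fin (m + 1) → TwoBits => ¬ labelDot s (u + v) = 0).card ≤
      (Finset.univ.filter fun s => ¬ roundParity s u = roundParity s v).card := by
    refine Finset.card_le_card fun s hs => ?_
    have hs' := (Finset.mem_filter.1 hs).2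
    have hs0 : s ≠ 0 := by
      rintro rfl
      exact hs' (by simp [labelDot])
    refine Finset.mem_filter.2 ⟨Finset.mem_univ _, ?_⟩
    rwa [roundParity_eq_labelDot hs0, roundParity_eq_labelDot hs0, ← bit_add_eq_zero_iff,
      ← labelDot_add_right]
  have h1 := Finset.card_filter_add_card_filter_not (s := Finset.univ)
    (fun s : Fin (m + 1) → TwoBits => labelDot s (u + v) = 0)
  have h2 := Finset.card_filter_add_card_filter_not (s := Finset.univ)
    (fun s : Fin (m + 1) → TwoBits => roundParity s u = roundParity s v)
  rw [Finset.card_univ] at h1 h2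
  omega

/-! ### Transcripts -/

/-- The probability of a transcript of the protocol on the Bell state with label `x`. -/
def transcriptProb (m : ℕ) : (r : ℕ) → (Fin (m + r) → TwoBits) → Transcript m r → ℝ
  | 0, _, _ => 1
  | r + 1, x, t =>
    (Fintype.card (Fin (m + r + 1) → TwoBits) : ℝ)⁻¹ *
      (if t.1.2.1 = t.1.2.2 + roundParity t.1.1 x then 1 / 2 else 0) *
        transcriptProb m r (roundLabel t.1.1 x) t.2

/-- The label of the Bell state that remains after the protocol on the Bell state with label `x`. -/
def finalLabel (m : ℕ) : (r : ℕ) → (Fin (m + r) → TwoBits) → Transcript m r → Fin m → TwoBits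
  | 0, x, _ => x
  | r + 1, x, t => finalLabel m r (roundLabel t.1.1 x) t.2

lemma roundBranch_isLinearMap {m : ℕ} (s : Fin (m + 1) → TwoBits) (y : Bit × Bit) :
    IsLinearMap ℂ (roundBranch s y) where
  map_add A B := by
    simp only [roundBranch, mul_add, add_mul, measureAndDiscard, Matrix.submatrix_add, Pi.add_apply]
  map_smul c A := by
    simp only [roundBranch, mul_smul_comm, smul_mul_assoc, measureAndDiscard, Matrix.submatrix_smul,
      Pi.smul_apply]

lemma branch_isLinearMap (m r : ℕ) (t : Transcript m r) :
    IsLinearMap ℂ fun ρ => branch m r ρ t := by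
  induction r with
  | zero => exact ⟨fun _ _ => rfl, fun _ _ => rfl⟩
  | succ r ih =>
    refine ⟨fun A B => ?_, fun c A => ?_⟩
    · simp only [branch]
      rw [(roundBranch_isLinearMap _ _).map_add, smul_add, (ih _).map_add]
    · simp only [branch]
      rw [(roundBranch_isLinearMap _ _).map_smul, smul_comm, (ih _).map_smul]

lemma branch_bellProj (m r : ℕ) (x : Fin (m + r) → TwoBits) (t : Transcript m r) :
    branch m r (bellProj x) t = (transcriptProb m r x t : ℂ) • bellProj (finalLabel m r x t) := by
  induction r with
  | zero => simp [branch, transcriptProb, finalLabel]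
  | succ r ih =>
    simp only [branch, transcriptProb, finalLabel]
    rw [roundBranch_bellProj, smul_smul, (branch_isLinearMap m r t.2).map_smul, ih, smul_smul]
    congr 1
    push_cast
    split_ifs <;> simp

lemma branch_sum_bellProj (m r : ℕ) (P : (Fin (m + r) → TwoBits) → ℝ) (t : Transcript m r) :
    branch m r (∑ x, (P x : ℂ) • bellProj x) t =
      ∑ x, ((P x * transcriptProb m r x t : ℝ) : ℂ) • bellProj (finalLabel m r x t) := by
  have h := map_sum (branch_isLinearMap m r t).mk' (fun x => (P x : ℂ) • bellProj x) Finset.univ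
  simp only [IsLinearMap.mk'_apply] at h
  rw [h]
  refine Finset.sum_congr rfl fun x _ => ?_
  rw [(branch_isLinearMap m r t).map_smul, branch_bellProj, smul_smul, Complex.ofReal_mul]

/-- The transcript that extends `t` by a first round with string `s` and outcomes `y`. -/
def Transcript.cons {m r : ℕ} (s : Fin (m + r + 1) → TwoBits) (y : Bit × Bit)
    (t : Transcript m r) : Transcript m (r + 1) := ((s, y), t)

lemma transcriptProb_cons {m r : ℕ} (x s : Fin (m + r + 1) → TwoBits) (y : Bit × Bit)
    (t : Transcript m r) :
    transcriptProb m (r + 1) x (.cons s y t) =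
      (Fintype.card (Fin (m + r + 1) → TwoBits) : ℝ)⁻¹ *
        (if y.1 = y.2 + roundParity s x then 1 / 2 else 0) *
          transcriptProb m r (roundLabel s x) t := rfl

lemma finalLabel_cons {m r : ℕ} (x s : Fin (m + r + 1) → TwoBits) (y : Bit × Bit)
    (t : Transcript m r) :
    finalLabel m (r + 1) x (.cons s y t) = finalLabel m r (roundLabel s x) t := rfl

lemma sum_transcript_succ (m r : ℕ) (f : Transcript m (r + 1) → ℝ) :
    ∑ t, f t = ∑ s : Fin (m + r + 1) → TwoBits, ∑ y : Bit × Bit, ∑ t : Transcript m r,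
      f (.cons s y t) := by
  have h : ∀ g : ((Fin (m + r + 1) → TwoBits) × (Bit × Bit)) × Transcript m r → ℝ,
      ∑ t, g t = ∑ s, ∑ y, ∑ t, g ((s, y), t) := fun g => by
    rw [Fintype.sum_prod_type, Fintype.sum_prod_type]
  exact h f

lemma transcriptProb_nonneg (m r : ℕ) (x : Fin (m + r) → TwoBits) (t : Transcript m r) :
    0 ≤ transcriptProb m r x t := by
  induction r with
  | zero => exact zero_le_one
  | succ r ih =>
    refine mul_nonneg (mul_nonneg (by positivity) ?_) (ih _ _)
    split_ifs <;> norm_num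

lemma sum_outcomes (b : Bit) :
    ∑ y : Bit × Bit, (if y.1 = y.2 + b then (1 / 2 : ℝ) else 0) = 1 := by
  rw [Fintype.sum_prod_type_right]
  simp

lemma sum_transcriptProb (m r : ℕ) (x : Fin (m + r) → TwoBits) :
    ∑ t, transcriptProb m r x t = 1 := by
  induction r with
  | zero => exact Fintype.sum_unique (ι := Unit) _
  | succ r ih =>
    rw [sum_transcript_succ]
    simp only [transcriptProb_cons, ← Finset.mul_sum, ih, mul_one, sum_outcomes]
    rw [Finset.sum_const, Finset.card_univ, nsmul_eq_mul, mul_inv_cancel₀]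
    exact_mod_cast Fintype.card_ne_zero

/-- The probability that the protocol on `u` does not tell `u` and `v` apart although it leaves
them in different Bell states. -/
def collisionProb (m r : ℕ) (u v : Fin (m + r) → TwoBits) : ℝ :=
  ∑ t, if transcriptProb m r v t ≠ 0 ∧ finalLabel m r u t ≠ finalLabel m r v t then
    transcriptProb m r u t else 0

/-- Distinct labels may merge in a round. Since only different final labels count as a collision,
merged labels contribute nothing and the induction can range over all pairs. -/
lemma collisionProb_self (m r : ℕ) (u : Fin (m + r) → TwoBits) : collisionProb m r u u = 0 := by
  simp [collisionProb]

/-- If the first parities differ, no outcome is possible for both labels; otherwise the bound `c`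
applies to the two labels after the round. -/
lemma collisionProb_succ_le (m r : ℕ) (u v : Fin (m + r + 1) → TwoBits) {c : ℝ} (hc : 0 ≤ c)
    (h : ∀ u v, collisionProb m r u v ≤ c) :
    collisionProb m (r + 1) u v ≤ ∑ s : Fin (m + r + 1) → TwoBits,
      if roundParity s u = roundParity s v then
        (Fintype.card (Fin (m + r + 1) → TwoBits) : ℝ)⁻¹ * c else 0 := by
  rw [collisionProb, sum_transcript_succ]
  refine Finset.sum_le_sum fun s _ => ?_
  have hy : ∀ y : Bit × Bit, (∑ t : Transcript m r,
      if transcriptProb m (r + 1) v (.cons s y t) ≠ 0 ∧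
        finalLabel m (r + 1) u (.cons s y t) ≠ finalLabel m (r + 1) v (.cons s y t) then
        transcriptProb m (r + 1) u (.cons s y t) else 0) ≤
      if roundParity s u = roundParity s v then
        (Fintype.card (Fin (m + r + 1) → TwoBits) : ℝ)⁻¹ * c *
          (if y.1 = y.2 + roundParity s u then 1 / 2 else 0) else 0 := by
    intro y
    simp only [transcriptProb_cons, finalLabel_cons]
    by_cases hu : y.1 = y.2 + roundParity s u
    · by_cases hv : y.1 = y.2 + roundParity s v
      · have huv : roundParity s u = roundParity s v := add_left_cancel (hu.symm.trans hv)
        simp only [if_pos huv, if_pos hu, if_pos hv]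
        rw [mul_right_comm _ c]
        refine le_trans (le_of_eq ?_) (mul_le_mul_of_nonneg_left
          (h (roundLabel s u) (roundLabel s v)) (by positivity))
        rw [collisionProb, Finset.mul_sum]
        refine Finset.sum_congr rfl fun t _ => ?_
        rw [mul_ite, mul_zero]
        refine if_congr (and_congr_left' ?_) rfl rfl
        simp
      · simp only [if_neg hv, mul_zero, zero_mul, ne_eq, not_true_eq_false, false_and, if_false,
          Finset.sum_const_zero]
        split_ifs <;> positivity
    · simp [if_neg hu]
  refine (Finset.sum_le_sum fun y _ => hy y).trans (le_of_eq ?_)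
  split_ifs
  · rw [← Finset.mul_sum, sum_outcomes, mul_one]
  · simp

lemma collisionProb_le (m r : ℕ) (u v : Fin (m + r) → TwoBits) :
    collisionProb m r u v ≤ (1 / 2) ^ r := by
  induction r with
  | zero =>
    refine (Finset.sum_le_sum fun t _ => ?_).trans_eq
      ((sum_transcriptProb m 0 u).trans (pow_zero _).symm)
    split_ifs
    · exact le_rfl
    · exact transcriptProb_nonneg _ _ _ _
  | succ r ih =>
    change Fin (m + r + 1) → TwoBits at u v
    by_cases huv : u = v
    · rw [huv, collisionProb_self]; positivity
    refine (collisionProb_succ_le m r u v (by positivity) ih).trans ?_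
    rw [← Finset.sum_filter, Finset.sum_const, nsmul_eq_mul, pow_succ]
    have h : (2 : ℝ) * (Finset.univ.filter fun s => roundParity s u = roundParity s v).card ≤
      (Fintype.card (Fin (m + r + 1) → TwoBits) : ℝ) := by
      exact_mod_cast two_mul_card_roundParity_eq_le huv
    have hpos : (0 : ℝ) < (Fintype.card (Fin (m + r + 1) → TwoBits) : ℝ) := by
      exact_mod_cast Fintype.card_pos
    rw [← mul_assoc, mul_comm _ ((1 / 2 : ℝ) ^ r)]
    refine mul_le_mul_of_nonneg_left ?_ (by positivity)
    rw [← div_eq_mul_inv, div_le_iff₀ hpos]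
    linarith

/-! ### Fidelity with a pure state -/

section Fidelity

variable {ι : Type} [Fintype ι] [DecidableEq ι]

open scoped MatrixOrder in
lemma matSqrt_mul_self {A : Matrix ι ι ℂ} (hA : A.PosSemidef) : matSqrt A * matSqrt A = A := by
  have hsa : IsSelfAdjoint A := hA.isHermitian
  rw [matSqrt, ← cfc_mul Real.sqrt Real.sqrt A (by fun_prop) (by fun_prop)]
  refine (cfc_congr (g := id) fun x hx => ?_).trans (cfc_id ℝ A)
  exact Real.mul_self_sqrt (spectrum_nonneg_of_nonneg hA.nonneg hx)

open scoped MatrixOrder in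
lemma matSqrt_of_mul_self {A B : Matrix ι ι ℂ} (hB : B.PosSemidef) (h : B * B = A) :
    matSqrt A = B := by
  have hsa : IsSelfAdjoint B := hB.isHermitian
  have hA : A = cfc (fun x : ℝ => x * x) B := by
    rw [cfc_mul (fun x : ℝ => x) (fun x : ℝ => x) B, cfc_id' ℝ B, h]
  rw [matSqrt, hA, ← cfc_comp' Real.sqrt (fun x : ℝ => x * x) B]
  refine (cfc_congr (g := id) fun x hx => ?_).trans (cfc_id ℝ B)
  exact Real.sqrt_mul_self (spectrum_nonneg_of_nonneg hB.nonneg hx)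

lemma conjTranspose_matSqrt (A : Matrix ι ι ℂ) : (matSqrt A).conjTranspose = matSqrt A :=
  (cfc_predicate Real.sqrt A : IsSelfAdjoint _)

/-- The projector `σ` is its own square root and `σ ρ σ = c σ` with `c` the overlap, so the trace
norm is `√c`. As `σ` has trace one, the second term vanishes whatever the trace of `ρ`. -/
lemma fidelity_pure {ρ : Matrix ι ι ℂ} (hρ : ρ.PosSemidef) {v : ι → ℂ} (hv : star v ⬝ᵥ v = 1) :
    fidelity ρ (Matrix.vecMulVec v (star v)) = (star v ⬝ᵥ ρ.mulVec v).re := by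
  set σ := Matrix.vecMulVec v (star v) with hσ
  have hσpos : σ.PosSemidef := Matrix.posSemidef_vecMulVec_self_star v
  have hσσ : σ * σ = σ := by
    rw [hσ, Matrix.vecMulVec_mul_vecMulVec, hv, one_smul]
  have htr : σ.trace = 1 := by
    rw [hσ, Matrix.trace_vecMulVec, dotProduct_comm, hv]
  have hc := hρ.dotProduct_mulVec_nonneg v
  set c := (star v ⬝ᵥ ρ.mulVec v).re with hcdef
  have hc0 : 0 ≤ c := (Complex.nonneg_iff.1 hc).1
  have hceq : star v ⬝ᵥ ρ.mulVec v = (c : ℂ) :=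
    Complex.ext rfl (Complex.nonneg_iff.1 hc).2.symm
  have hprod : (matSqrt ρ * σ).conjTranspose * (matSqrt ρ * σ) = (c : ℂ) • σ := by
    rw [Matrix.conjTranspose_mul, conjTranspose_matSqrt, hσpos.isHermitian.eq, mul_assoc,
      ← mul_assoc (matSqrt ρ), matSqrt_mul_self hρ, hσ, Matrix.mul_vecMulVec,
      Matrix.vecMulVec_mul_vecMulVec, hceq, Matrix.vecMulVec_smul]
  have hsq : matSqrt ((c : ℂ) • σ) = (Real.sqrt c : ℂ) • σ := by
    refine matSqrt_of_mul_self (hσpos.smul (by exact_mod_cast Real.sqrt_nonneg c)) ?_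
    rw [smul_mul_smul_comm, hσσ, ← Complex.ofReal_mul, Real.mul_self_sqrt hc0]
  rw [fidelity, matSqrt_of_mul_self hσpos hσσ, traceNorm, hprod, hsq, Matrix.trace_smul, htr]
  simp [Real.sq_sqrt hc0]

end Fidelity

/-! ### The output of the protocol -/

lemma sum_star_mul_bellAmplitude (x : TwoBits) :
    ∑ α, ∑ β, star (bellAmplitude x α β) * bellAmplitude x α β = 1 := by
  have hsqrt : star (Real.sqrt 2 : ℂ)⁻¹ * (Real.sqrt 2 : ℂ)⁻¹ = 1 / 2 := by
    rw [star_inv₀, Complex.star_def, Complex.conj_ofReal, ← mul_inv, ← Complex.ofReal_mul,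
      Real.mul_self_sqrt (by norm_num)]
    norm_num
  have h : ∀ α β, star (bellAmplitude x α β) * bellAmplitude x α β =
      if β = α + x.2 then 1 / 2 else 0 := by
    intro α β
    have hiff : (α = β + x.2) ↔ β = α + x.2 := by
      generalize x.2 = c
      revert α β c; decide
    rw [bellAmplitude_eq, if_congr hiff rfl rfl]
    split_ifs
    · rw [mul_one, star_mul', mul_mul_mul_comm, hsqrt, mul_comm (star _), bitSign_mul_star, mul_one]
    · simp
  simp only [h, Finset.sum_ite_eq', Finset.mem_univ, if_true, bit_sum]
  norm_num

lemma bellVec_norm {n : ℕ} (x : Fin n → TwoBits) : star (bellVec x) ⬝ᵥ bellVec x = 1 := by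
  have h : ∀ p : Reg n × Reg n, star (bellVec x) p * bellVec x p =
      ∏ j, star (bellAmplitude (x j) (p.1 j) (p.2 j)) * bellAmplitude (x j) (p.1 j) (p.2 j) :=
    fun p => by rw [Finset.prod_mul_distrib, Pi.star_apply, bellVec, star_prod]
  have hprod : ∀ g : Fin n → Bit → ℂ, ∑ q : Reg n, ∏ j, g j (q j) = ∏ j, ∑ b, g j b := fun g => by
    rw [Finset.prod_univ_sum, Fintype.piFinset_univ]
  simp only [dotProduct, h, Fintype.sum_prod_type]
  have h' : ∀ a : Reg n, ∑ q : Reg n,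
      ∏ j, star (bellAmplitude (x j) (a j) (q j)) * bellAmplitude (x j) (a j) (q j) =
        ∏ j, ∑ b, star (bellAmplitude (x j) (a j) b) * bellAmplitude (x j) (a j) b := fun a =>
    hprod fun j b => star (bellAmplitude (x j) (a j) b) * bellAmplitude (x j) (a j) b
  simp only [h']
  rw [hprod fun j a => ∑ b, star (bellAmplitude (x j) a b) * bellAmplitude (x j) a b]
  exact Finset.prod_eq_one fun j _ => sum_star_mul_bellAmplitude _

lemma bellProj_posSemidef {n : ℕ} (x : Fin n → TwoBits) : (bellProj x).PosSemidef :=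
  Matrix.posSemidef_vecMulVec_self_star _

lemma posSemidef_sum_bellProj {α : Type} [Fintype α] {n : ℕ} {c : α → ℝ} (hc : ∀ i, 0 ≤ c i)
    (x : α → Fin n → TwoBits) : (∑ i, (c i : ℂ) • bellProj (x i)).PosSemidef :=
  Matrix.posSemidef_sum _ fun i _ => (bellProj_posSemidef _).smul (by exact_mod_cast hc i)

lemma bobCorrection_conjTranspose_mulVec {m : ℕ} (x : Fin m → TwoBits) :
    (bobCorrection x).conjTranspose.mulVec (bellVec fun _ => 0) = bellVec x := by
  have h : bellVec (fun _ : Fin m => (0 : TwoBits)) =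
      fun p => (tensorOp fun _ => (Real.sqrt 2 : ℂ)⁻¹ • pauli 0) p.1 p.2 := rfl
  -- The entries of `Z^a X^b` are real.
  have hp : ∀ x : TwoBits, (pauli x).conjTranspose.transpose = pauli x := fun x => by
    ext α β
    simp only [Matrix.transpose_apply, Matrix.conjTranspose_apply, pauli_apply, bitSign]
    split_ifs <;> simp
  have hp0 : pauli 0 = 1 := by simp [pauli]
  have ht : (tensorOp fun j => pauli (x j)).conjTranspose.transpose =
      tensorOp fun j => (pauli (x j)).conjTranspose.transpose := by
    ext a b
    simp [tensorOp]
  ext p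
  rw [h, bobCorrection, Matrix.conjTranspose_kronecker, kronecker_mulVec_apply,
    Matrix.conjTranspose_one, one_mul, ht, tensorOp_mul]
  simp only [hp, hp0, smul_mul_assoc, one_mul]
  rfl

lemma targetState_eigenvalue_postProcess {m : ℕ} (B : PairOp m) :
    (star (bellVec fun _ : Fin m => 0) ⬝ᵥ (postProcess B).mulVec (bellVec fun _ => 0)).re =
      bellEigenvalue B (topLabel B) := by
  rw [bellEigenvalue, ← bobCorrection_conjTranspose_mulVec (topLabel B), Matrix.star_mulVec,
    Matrix.conjTranspose_conjTranspose, postProcess, ← Matrix.mulVec_mulVec, ← Matrix.mulVec_mulVec,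
    Matrix.dotProduct_mulVec]

lemma bellEigenvalue_le_topLabel {m : ℕ} (B : PairOp m) (x : Fin m → TwoBits) :
    bellEigenvalue B x ≤ bellEigenvalue B (topLabel B) :=
  Classical.choose_spec (Finite.exists_max (bellEigenvalue B)) x

lemma bellEigenvalue_sum {α : Type} [Fintype α] {m : ℕ} (c : α → ℝ) (x : α → Fin m → TwoBits)
    (z : Fin m → TwoBits) :
    bellEigenvalue (∑ i, (c i : ℂ) • bellProj (x i)) z =
      ∑ i, c i * bellEigenvalue (bellProj (x i)) z := by
  simp only [bellEigenvalue, Matrix.sum_mulVec, dotProduct_sum, Complex.re_sum, Matrix.smul_mulVec,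
    dotProduct_smul, smul_eq_mul, Complex.re_ofReal_mul]

lemma bellEigenvalue_bellProj_self {m : ℕ} (x : Fin m → TwoBits) :
    bellEigenvalue (bellProj x) x = 1 := by
  rw [bellEigenvalue, bellProj, Matrix.vecMulVec_mulVec, bellVec_norm]
  simp [bellVec_norm]

lemma bellEigenvalue_bellProj_nonneg {m : ℕ} (x z : Fin m → TwoBits) :
    0 ≤ bellEigenvalue (bellProj x) z :=
  (Complex.nonneg_iff.1 ((bellProj_posSemidef x).dotProduct_mulVec_nonneg _)).1

lemma fidelity_hashOutput (m r : ℕ) {P : (Fin (m + r) → TwoBits) → ℝ} (hP : ∀ x, 0 ≤ P x) :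
    fidelity (hashOutput m r (∑ x, (P x : ℂ) • bellProj x)) (targetState m) =
      ∑ t, bellEigenvalue (branch m r (∑ x, (P x : ℂ) • bellProj x) t)
        (topLabel (branch m r (∑ x, (P x : ℂ) • bellProj x) t)) := by
  have hpos : (hashOutput m r (∑ x, (P x : ℂ) • bellProj x)).PosSemidef := by
    refine Matrix.posSemidef_sum _ fun t _ => ?_
    rw [postProcess]
    refine Matrix.PosSemidef.mul_mul_conjTranspose_same ?_ _
    rw [branch_sum_bellProj]
    exact posSemidef_sum_bellProj (fun x => mul_nonneg (hP x) (transcriptProb_nonneg _ _ _ _)) _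
  rw [targetState, bellProj, fidelity_pure hpos (bellVec_norm _), hashOutput, Matrix.sum_mulVec,
    dotProduct_sum, Complex.re_sum]
  exact Finset.sum_congr rfl fun t _ => targetState_eigenvalue_postProcess _

/-- Here `z` is an arbitrary guessing strategy, and the largest eigenvalue beats it on every
transcript. Labels that the guess misses are merely bounded below by zero, so orthogonality of Bell
states is not needed. -/
lemma sum_finalLabel_eq_le (m r : ℕ) {P : (Fin (m + r) → TwoBits) → ℝ} (hP : ∀ x, 0 ≤ P x)
    (z : Transcript m r → Fin m → TwoBits) :
    ∑ t, ∑ x, (if finalLabel m r x t = z t then P x * transcriptProb m r x t else 0) ≤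
      fidelity (hashOutput m r (∑ x, (P x : ℂ) • bellProj x)) (targetState m) := by
  rw [fidelity_hashOutput m r hP]
  refine Finset.sum_le_sum fun t _ => le_trans ?_ (bellEigenvalue_le_topLabel _ (z t))
  rw [branch_sum_bellProj, bellEigenvalue_sum]
  refine Finset.sum_le_sum fun x _ => ?_
  have h0 := mul_nonneg (hP x) (transcriptProb_nonneg m r x t)
  split_ifs with h
  · rw [← h, bellEigenvalue_bellProj_self, mul_one]
  · exact mul_nonneg h0 (bellEigenvalue_bellProj_nonneg _ _)

/-- Guessing, from the transcript, any label in the support that is consistent with it identifies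
the final Bell state except with probability `|supp P| / 2 ^ r`. -/
lemma one_sub_le_fidelity_hashOutput (m r : ℕ) {P : (Fin (m + r) → TwoBits) → ℝ}
    (hP : ∀ x, 0 ≤ P x) (hsum : ∑ x, P x = 1) :
    1 - (({x | 0 < P x} : Set _).ncard : ℝ) * (1 / 2) ^ r ≤
      fidelity (hashOutput m r (∑ x, (P x : ℂ) • bellProj x)) (targetState m) := by
  classical
  set S : Finset (Fin (m + r) → TwoBits) := Finset.univ.filter fun x => 0 < P x with hS
  have hcard : ({x | 0 < P x} : Set _).ncard = S.card := by
    rw [← Set.ncard_coe_finset]; congr 1; ext x; simp [hS]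
  -- The guess is the final label of some supported label compatible with `t`; if there is none, its
  -- value is irrelevant.
  have hz : ∀ t, ∃ z : Fin m → TwoBits, ∀ x ∈ S, transcriptProb m r x t ≠ 0 →
      ∃ v ∈ S, transcriptProb m r v t ≠ 0 ∧ finalLabel m r v t = z := by
    intro t
    by_cases h : ∃ v ∈ S, transcriptProb m r v t ≠ 0
    · obtain ⟨v, hv, hvt⟩ := h
      exact ⟨_, fun _ _ _ => ⟨v, hv, hvt, rfl⟩⟩
    · exact ⟨0, fun x hx hxt => absurd ⟨x, hx, hxt⟩ h⟩
  choose z hz using hz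
  refine le_trans ?_ (sum_finalLabel_eq_le m r hP z)
  -- Union bound: the guess can fail for `x` only if some compatible `v ∈ S` ends in a different
  -- label.
  have hpt : ∀ t x, P x * transcriptProb m r x t -
      P x * ∑ v ∈ S, (if transcriptProb m r v t ≠ 0 ∧ finalLabel m r x t ≠ finalLabel m r v t then
        transcriptProb m r x t else 0) ≤
      if finalLabel m r x t = z t then P x * transcriptProb m r x t else 0 := by
    intro t x
    have hW := transcriptProb_nonneg m r x t
    have hterm : ∀ v ∈ S, 0 ≤ (if transcriptProb m r v t ≠ 0 ∧
        finalLabel m r x t ≠ finalLabel m r v t then transcriptProb m r x t else 0) := by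
      intro v _
      split_ifs
      · exact hW
      · exact le_rfl
    split_ifs with hx
    · exact sub_le_self _ (mul_nonneg (hP x) (Finset.sum_nonneg hterm))
    · rcases (hP x).eq_or_lt with h0 | h0
      · simp [← h0]
      by_cases hW0 : transcriptProb m r x t = 0
      · simp [hW0]
      obtain ⟨v, hv, hvt, hvz⟩ := hz t x (Finset.mem_filter.2 ⟨Finset.mem_univ _, h0⟩) hW0
      rw [sub_nonpos]
      refine mul_le_mul_of_nonneg_left (le_trans ?_ (Finset.single_le_sum hterm hv)) (hP x)
      rw [if_pos ⟨hvt, by rwa [hvz]⟩]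
  refine le_trans ?_ (Finset.sum_le_sum fun t _ => Finset.sum_le_sum fun x _ => hpt t x)
  rw [Finset.sum_comm]
  have hx : ∀ x, P x - P x * (S.card * (1 / 2) ^ r) ≤ ∑ t, (P x * transcriptProb m r x t -
      P x * ∑ v ∈ S, (if transcriptProb m r v t ≠ 0 ∧ finalLabel m r x t ≠ finalLabel m r v t then
        transcriptProb m r x t else 0)) := by
    intro x
    rw [Finset.sum_sub_distrib, ← Finset.mul_sum, ← Finset.mul_sum, sum_transcriptProb, mul_one,
      Finset.sum_comm]
    refine sub_le_sub_left (mul_le_mul_of_nonneg_left ?_ (hP x)) _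
    rw [← nsmul_eq_mul]
    exact Finset.sum_le_card_nsmul _ _ _ fun v _ => collisionProb_le m r x v
  refine le_trans (le_of_eq ?_) (Finset.sum_le_sum fun x _ => hx x)
  rw [Finset.sum_sub_distrib, ← Finset.sum_mul, hsum, one_mul, hcard]

lemma purifiedDistance_hashOutput_le {m r : ℕ} {ρ : PairOp (m + r)}
    {P : (Fin (m + r) → TwoBits) → ℝ} (hρ : IsBellDiagonalState ρ P) {ε : ℝ} (hε : 0 < ε)
    (hr : hartley P - 2 * Real.logb 2 ε ≤ r) :
    purifiedDistance (hashOutput m r ρ) (targetState m) ≤ ε := by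
  have hF := one_sub_le_fidelity_hashOutput m r hρ.nonneg hρ.sum_eq_one
  rw [← hρ.eq_sum] at hF
  -- A nonempty support is needed to take the logarithm of the quotient apart.
  have hN : 0 < (({x | 0 < P x} : Set _).ncard : ℝ) := by
    rw [Nat.cast_pos, Set.ncard_pos]
    by_contra h
    have h0 : ∀ x, P x = 0 := fun x =>
      le_antisymm (not_lt.1 fun hx => h ⟨x, hx⟩) (hρ.nonneg x)
    simpa [h0] using hρ.sum_eq_one
  have hle : (({x | 0 < P x} : Set _).ncard : ℝ) * (1 / 2) ^ r ≤ ε ^ 2 := by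
    have h2 : Real.logb 2 ((({x | 0 < P x} : Set _).ncard : ℝ) / ε ^ 2) ≤ r := by
      rw [Real.logb_div hN.ne' (by positivity), Real.logb_pow]
      exact_mod_cast hr
    rw [Real.logb_le_iff_le_rpow (by norm_num) (by positivity), Real.rpow_natCast,
      div_le_iff₀ (by positivity)] at h2
    rw [one_div, inv_pow, ← div_eq_mul_inv, div_le_iff₀ (by positivity)]
    linarith
  exact Real.sqrt_le_iff.2 ⟨hε.le, by linarith⟩

lemma le_maxBellPairs {m r : ℕ} {ρ : PairOp (m + r)} {ε : ℝ}
    (h : purifiedDistance (hashOutput m r ρ) (targetState m) ≤ ε) : m ≤ maxBellPairs ρ ε := by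
  -- The supremum in `ℕ` is meaningful only for a bounded set; no more pairs can remain than were
  -- present initially.
  refine le_csSup ⟨m + r, ?_⟩ ⟨r, rfl, h⟩
  rintro k ⟨l, hl, -⟩
  omega

lemma sub_ceil_le_maxBellPairs {n : ℕ} {ρ : PairOp n} {P : (Fin n → TwoBits) → ℝ}
    (hρ : IsBellDiagonalState ρ P) {ε : ℝ} (hε : 0 < ε)
    (hr : 0 ≤ ⌈hartley P - 2 * Real.logb 2 ε⌉) :
    (n : ℤ) - ⌈hartley P - 2 * Real.logb 2 ε⌉ ≤ (maxBellPairs ρ ε : ℤ) := by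
  obtain ⟨r, hr'⟩ := Int.eq_ofNat_of_zero_le hr
  rcases le_or_gt r n with hrn | hrn
  · obtain ⟨m, rfl⟩ : ∃ m, n = m + r := ⟨n - r, by omega⟩
    have hle : hartley P - 2 * Real.logb 2 ε ≤ r := by
      have := Int.le_ceil (hartley P - 2 * Real.logb 2 ε)
      rw [hr'] at this
      exact_mod_cast this
    have := le_maxBellPairs (purifiedDistance_hashOutput_le hρ hε hle)
    omega
  -- More rounds than pairs: the left side is negative.
  · omega

end OneWayHashing

end

theorem mainTheorem4 {n : ℕ} (ρ : OneWayHashing.PairOp n)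
    (P : (Fin n → OneWayHashing.TwoBits) → ℝ)
    (hρ : OneWayHashing.IsBellDiagonalState ρ P)
    (ε : ℝ) (hε : 0 < ε)
    (hr : 0 ≤ ⌈OneWayHashing.hartley P - 2 * Real.logb 2 ε⌉) :
    (n : ℤ) - ⌈OneWayHashing.hartley P - 2 * Real.logb 2 ε⌉
        ≤ (OneWayHashing.maxBellPairs ρ ε : ℤ) ∧
      ((n : ℝ) - (⌈OneWayHashing.hartley P - 2 * Real.logb 2 ε⌉ : ℤ)) / n
        ≤ OneWayHashing.distillationRate ρ ε := by
  have h := OneWayHashing.sub_ceil_le_maxBellPairs hρ hε hr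
  -- For `n = 0` both quotients are zero by convention.
  exact ⟨h, div_le_div_of_nonneg_right (by exact_mod_cast h) n.cast_nonneg⟩
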